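/- Let $\mathcal L$ be the category whose objects are the natural numbers $n$ (standing for $[n]=\{0,\dots,n-1\}$) and whose morphisms $m\to n$ are the total injective increasing functions $[m]\to[n]$. A \emph{free conservative finite cocompletion} of $\mathcal L$ is a category $\mathcal P$ with all finite colimits, together with a full and faithful functor $y:\mathcal L\to\mathcal P$ preserving those finite colimits that exist in $\mathcal L$, such that for every category $\mathcal E$ with finite colimits and every functor $F:\mathcal L\to\mathcal E$ preserving those finite colimits that exist in $\mathcal L$, there is a functor $\tilde F:\mathcal P\to\mathcal E$ preserving finite colimits with $\tilde F\circ y\cong F$, and $\tilde F$ (with this isomorphism) is unique up to a unique isomorphism compatible with the isomorphisms to $F$. It is determined up to equivalence. Let $\mathcal G$ be the full subcategory of $\mathcal L$ on the objects $1$ and $2$. Its presheaves are the (directed multi)graphs: a presheaf $P$ has vertex set $P(1)$, edge set $P(2)$, and the source and target of an edge are given by the maps $1\to 2$ sending $0$ to $0$ and to $1$ respectively. \textbf{Theorem.} The free conservative finite cocompletion of $\mathcal L$ exists and is equivalent to the full subcategory of the category $\hat{\mathcal G}$ of graphs whose objects are the finite graphs such that for every non-empty path $x\twoheadrightarrow y$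 there exists exactly one edge $x\to y$; the embedding of $\mathcal L$ sends $n$ to the graph with vertex set $[n]$ and exactly one edge $i\to j$ whenever $i<j$, and no other edges. Equivalently, it is the category whose objects are finite sets equipped with a transitive relation $<$ and whose morphisms are the functions respecting the relations; here $n$ is sent to $[n]$ with its usual strict order, and the equivalence with the previous description sends a graph to its set of vertices, with $x<y$ if and only if there is an edge $x\to y$. -/

import Mathlib

open CategoryTheory CategoryTheory.Limits

universe v u

namespace InsertionPatch

/-- The unlabeled insertion-only category `L`: its objects are the natural numbers `n`
(standing for `[n] = {0, …, n-1}`). -/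
structure L : Type where
  /-- the number of lines -/
  len : ℕ

/-- Morphisms `m ⟶ n` are the total injective increasing functions `[m] → [n]`, that is,
the order embeddings of `Fin m` into `Fin n`. -/
instance : Category.{0} L where
  Hom m n := Fin m.len ↪o Fin n.len
  id m := RelEmbedding.refl _
  comp f g := RelEmbedding.trans f g

/-- The function underlying a morphism of `L`. -/
def L.fn {m n : L} (f : m ⟶ n) : Fin m.len → Fin n.len :=
  fun i => (show Fin m.len ↪o Fin n.len from f) i

theorem L.fn_strictMono {m n : L} (f : m ⟶ n) : StrictMono (L.fn f) :=
  OrderEmbedding.strictMono (show Fin m.len ↪o Fin n.len from f)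

theorem L.fn_comp {m n p : L} (f : m ⟶ n) (g : n ⟶ p) (i : Fin m.len) :
    L.fn (f ≫ g) i = L.fn g (L.fn f i) := rfl

theorem L.hom_ext {m n : L} {f g : m ⟶ n} (h : ∀ i, L.fn f i = L.fn g i) : f = g :=
  RelEmbedding.ext h

/-- A strictly increasing function as a morphism of `L`. -/
def L.homMk {m n : L} (f : Fin m.len → Fin n.len) (hf : StrictMono f) : m ⟶ n :=
  OrderEmbedding.ofStrictMono f hf

/-- The property of being one of the objects `1` and `2` of `L`. -/
def oneTwo : ObjectProperty L := fun n => n.len = 1 ∨ n.len = 2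

/-- The full subcategory `G` of `L` on the objects `1` and `2`. -/
abbrev G : Type := oneTwo.FullSubcategory

/-- The object `1` of `G`. -/
def G.one : G := ⟨⟨1⟩, Or.inl rfl⟩

/-- The object `2` of `G`. -/
def G.two : G := ⟨⟨2⟩, Or.inr rfl⟩

/-- The arrow `1 ⟶ 2` of `G` given by the function `0 ↦ j`. The function `0 ↦ 0` is the
insertion `s₁` of a line after the given one, and `0 ↦ 1` is the insertion `s₀` of a line
before it. -/
def G.pt (j : Fin 2) : G.one ⟶ G.two :=
  ObjectProperty.homMk (L.homMk (m := ⟨1⟩) (n := ⟨2⟩) (fun _ => j)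
    (fun a b h => absurd h (by simp [Subsingleton.elim a b])))

/-- The category of graphs: presheaves on `G`. -/
abbrev Graph : Type 1 := Gᵒᵖ ⥤ Type

namespace Graph

/-- The vertices of a graph. -/
def V (P : Graph) : Type := P.obj (Opposite.op G.one)

/-- The edges of a graph. -/
def E (P : Graph) : Type := P.obj (Opposite.op G.two)

/-- The source of an edge. -/
def src (P : Graph) (e : P.E) : P.V := P.map (G.pt 0).op e

/-- The target of an edge. -/
def tgt (P : Graph) (e : P.E) : P.V := P.map (G.pt 1).op e

/-- `P.HasPath k x y`: there is a path of length `k` (a chain of `k` consecutive edges) from the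
vertex `x` to the vertex `y`. -/
inductive HasPath (P : Graph) : ℕ → P.V → P.V → Prop
  | nil (x : P.V) : HasPath P 0 x x
  | cons {k : ℕ} {x y : P.V} (h : HasPath P k x y) (e : P.E) (he : P.src e = y) :
      HasPath P (k + 1) x (P.tgt e)

end Graph

/-- The finite graphs such that for every non-empty path from `x` to `y` there is exactly one
edge from `x` to `y`. -/
def finTransitive : ObjectProperty Graph := fun P =>
  Finite P.V ∧ Finite P.E ∧
    ∀ (k : ℕ) (x y : P.V), 0 < k → P.HasPath k x y → ∃! e : P.E, P.src e = x ∧ P.tgt e = y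

/-- The full subcategory of the category of graphs on the graphs satisfying `finTransitive`. -/
abbrev TransGraph : Type 1 := finTransitive.FullSubcategory

/-- The nerve functor of the inclusion `G ⥤ L`, sending `n` to the graph `L(-, n)`. -/
def nerve : L ⥤ Graph :=
  yoneda ⋙ (Functor.whiskeringLeft Gᵒᵖ Lᵒᵖ Type).obj oneTwo.ι.op

/-- The vertex of the graph `nerve n` as an element of `[n]`. -/
def nerveVal {n : L} (x : (nerve.obj n).V) : Fin n.len :=
  L.fn (m := ⟨1⟩) (n := n) x (0 : Fin 1)

theorem nerveVal_injective {n : L} : Function.Injective (nerveVal (n := n)) := by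
  intro x y h
  refine L.hom_ext (m := ⟨1⟩) (n := n) ?_
  intro i
  have : i = (0 : Fin 1) := Subsingleton.elim (α := Fin 1) _ _
  subst this
  exact h

theorem nerveVal_src {n : L} (e : (nerve.obj n).E) :
    nerveVal ((nerve.obj n).src e) = L.fn (m := ⟨2⟩) (n := n) e (0 : Fin 2) := rfl

theorem nerveVal_tgt {n : L} (e : (nerve.obj n).E) :
    nerveVal ((nerve.obj n).tgt e) = L.fn (m := ⟨2⟩) (n := n) e (1 : Fin 2) := rfl

theorem nerveVal_lt {n : L} (e : (nerve.obj n).E) :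
    nerveVal ((nerve.obj n).src e) < nerveVal ((nerve.obj n).tgt e) := by
  rw [nerveVal_src, nerveVal_tgt]
  exact L.fn_strictMono _ (by decide : (0 : Fin 2) < 1)

theorem nerve_hasPath {n : L} {k : ℕ} {x y : (nerve.obj n).V}
    (h : (nerve.obj n).HasPath k x y) : nerveVal x ≤ nerveVal y ∧
      (0 < k → nerveVal x < nerveVal y) := by
  induction h with
  | nil => simp
  | cons h e he ih =>
    have h1 := nerveVal_lt e
    rw [he] at h1
    have h2 := lt_of_le_of_lt ih.1 h1
    exact ⟨h2.le, fun _ => h2⟩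

theorem nerve_finTransitive (n : L) : finTransitive (nerve.obj n) := by
  refine ⟨inferInstanceAs (Finite (Fin 1 ↪o Fin n.len)),
    inferInstanceAs (Finite (Fin 2 ↪o Fin n.len)), ?_⟩
  intro k x y hk h
  have hlt := (nerve_hasPath h).2 hk
  have hm : StrictMono (![nerveVal x, nerveVal y] : Fin 2 → Fin n.len) := by
    intro a b hab
    fin_cases a <;> fin_cases b <;> simp_all
  refine ⟨(L.homMk (m := ⟨2⟩) (n := n) _ hm), ⟨?_, ?_⟩, ?_⟩
  · exact nerveVal_injective rfl
  · exact nerveVal_injective rfl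
  · rintro e ⟨rfl, rfl⟩
    refine L.hom_ext (m := ⟨2⟩) (n := n) ?_
    intro i
    change Fin 2 at i
    fin_cases i <;> rfl

/-- The nerve functor, corestricted to `TransGraph`. -/
def toTransGraph : L ⥤ TransGraph :=
  finTransitive.lift nerve nerve_finTransitive

/-- Finite sets equipped with a transitive relation. -/
structure FinTransRel : Type 1 where
  /-- the underlying set -/
  carrier : Type
  /-- it is finite -/
  finite : Finite carrier
  /-- the relation -/
  rel : carrier → carrier → Prop
  /-- it is transitive -/
  trans : ∀ a b c, rel a b → rel b c → rel a c

/-- Morphisms are the functions `f` such that `a < b` implies `f a < f b`. -/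
instance : Category.{0} FinTransRel where
  Hom A B := RelHom A.rel B.rel
  id A := RelHom.id A.rel
  comp f g := RelHom.comp g f

/-- The functor sending `n` to `[n]` with its usual strict order. -/
def toFinTransRel : L ⥤ FinTransRel where
  obj n := ⟨Fin n.len, inferInstance, (· < ·), fun _ _ _ => lt_trans⟩
  map f := ⟨L.fn f, fun h => L.fn_strictMono f h⟩

theorem Graph.src_map {P Q : Graph} (f : P ⟶ Q) (e : P.E) :
    Q.src (f.app (Opposite.op G.two) e) = f.app (Opposite.op G.one) (P.src e) :=
  (NatTrans.naturality_apply f (G.pt 0).op e).symm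

theorem Graph.tgt_map {P Q : Graph} (f : P ⟶ Q) (e : P.E) :
    Q.tgt (f.app (Opposite.op G.two) e) = f.app (Opposite.op G.one) (P.tgt e) :=
  (NatTrans.naturality_apply f (G.pt 1).op e).symm

/-- The functor sending a graph in `TransGraph` to its set of vertices, with the relation
`x < y` if and only if there is an edge from `x` to `y`. -/
def vertexRel : TransGraph ⥤ FinTransRel where
  obj P :=
    { carrier := P.obj.V
      finite := P.property.1
      rel := fun x y => ∃ e : P.obj.E, P.obj.src e = x ∧ P.obj.tgt e = y
      trans := by
        rintro a b c ⟨e, rfl, rfl⟩ ⟨e', he', rfl⟩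
        exact (P.property.2.2 2 _ _ (by norm_num)
          (.cons (.cons (.nil _) e rfl) e' he')).exists }
  map f :=
    { toFun := f.hom.app (Opposite.op G.one)
      map_rel' := by
        rintro a b ⟨e, rfl, rfl⟩
        exact ⟨f.hom.app (Opposite.op G.two) e, Graph.src_map f.hom e, Graph.tgt_map f.hom e⟩ }

/-- `y : C ⥤ D` exhibits `D` as the free conservative finite cocompletion of `C`: the category
`D` has finite colimits, `y` is a full and faithful functor preserving the finite colimits
that exist in `C`, and every functor `F : C ⥤ E` preserving the finite colimits that exist in
`C`, into a category `E` with finite colimits, extends along `y` to a functor `D ⥤ E`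
preserving finite colimits, uniquely up to a unique isomorphism compatible with the extensions.
(Commutation `y ⋙ F' ≅ F` is up to a specified isomorphism, as `D` is only determined
up to equivalence.) -/
structure IsFreeConservativeFiniteCocompletion.{v', u', v₁, u₁, v₂, u₂} {C : Type u₁} [Category.{v₁} C]
    {D : Type u₂} [Category.{v₂} D] (y : C ⥤ D) : Prop where
  hasFiniteColimits : HasFiniteColimits D
  full : y.Full
  faithful : y.Faithful
  preserves : PreservesFiniteColimits y
  universal : ∀ (E : Type u') [Category.{v'} E] [HasFiniteColimits E] (F : C ⥤ E),
    PreservesFiniteColimits F →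
      ∃ (F' : D ⥤ E) (α : y ⋙ F' ≅ F), PreservesFiniteColimits F' ∧
        ∀ (F'' : D ⥤ E) (β : y ⋙ F'' ≅ F), PreservesFiniteColimits F'' →
          ∃! γ : F' ≅ F'', Functor.isoWhiskerLeft y γ ≪≫ β = α

end InsertionPatch

/-!
The graphs in `TransGraph` are the finite transitive relations: `vertexRel` is fully faithful
because an edge is determined by its endpoints, and a finite transitive relation `X` is recovered
from the graph with vertices `Hom (1, X)` and edges `Hom (2, X)`. So the work is with
`FinTransRel`.

*Conservativity.* A finite diagram in `L` has a colimit `X` in `FinTransRel`. If it also has a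
colimit `c` in `L`, then `c` is the reflection of `X` into finite ordinals. Two incomparable
elements of `X` could be put in either order by maps from `X` to ordinals, which is incompatible
with factoring through `c`; so `X` is linear and isomorphic to `c` (`isIso_of_reflection`).

*Extension.* Let `F : L ⥤ E` preserve the finite colimits that exist in `L`. The ordinal `n` is,
in `L`, the gluing of copies of `1` and `2` along any graph on `[n]` whose edges generate its
order (`L.isGluing`). Taking two parallel edges on `[2]` shows that morphisms `F 2 ⟶ Q` are
determined by their endpoints; taking the path `0 → 1 → 2` on `[3]` shows that "being the
endpoints of an edge `F 2 ⟶ Q`" is a transitive relation on the vertices `F 1 ⟶ Q` of `Q`. The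
extension sends `X` to an object representing the relation-preserving maps from `X` to the
vertices of `Q` (`IsRealization`), which is a finite gluing in `E`. It preserves finite colimits
since colimits of finite transitive relations have the universal property with respect to
transitive relations on arbitrary, also infinite, sets (`FinTransRel.colimitCocone_exists_desc`).

*Uniqueness.* Each `X` is the gluing of its elements along its related pairs, so a functor
preserving finite colimits sends `X` to a realization of `X`; hence natural transformations out of
such a functor are the same as those out of its restriction to `L`
(`whiskerLeft_toFinTransRel_bijective`). Two free cocompletions are then equivalent by the usual
argument, applied to a model of `FinTransRel` in the universes of the other one
(`smallModelEquivalence`).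
-/

namespace InsertionPatch

/-! ### Finite transitive relations and their finite colimits -/

namespace FinTransRel

/-- The function underlying a morphism of `FinTransRel`. -/
def fn {X Y : FinTransRel} (f : X ⟶ Y) : X.carrier → Y.carrier :=
  (show RelHom X.rel Y.rel from f).toFun

theorem rel_fn {X Y : FinTransRel} (f : X ⟶ Y) {a b : X.carrier} (h : X.rel a b) :
    Y.rel (fn f a) (fn f b) :=
  (show RelHom X.rel Y.rel from f).map_rel' h

/-- A relation-preserving function as a morphism of `FinTransRel`. -/
def homMk {X Y : FinTransRel} (f : X.carrier → Y.carrier)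
    (hf : ∀ a b, X.rel a b → Y.rel (f a) (f b)) : X ⟶ Y :=
  (⟨f, fun {a b} h => hf a b h⟩ : RelHom X.rel Y.rel)

@[simp] theorem fn_homMk {X Y : FinTransRel} (f : X.carrier → Y.carrier)
    (hf : ∀ a b, X.rel a b → Y.rel (f a) (f b)) : fn (homMk f hf) = f := rfl

@[ext] theorem hom_ext {X Y : FinTransRel} {f g : X ⟶ Y} (h : ∀ x, fn f x = fn g x) : f = g :=
  RelHom.ext (f := (f : RelHom X.rel Y.rel)) h

@[simp] theorem fn_comp {X Y Z : FinTransRel} (f : X ⟶ Y) (g : Y ⟶ Z) (x : X.carrier) :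
    fn (f ≫ g) x = fn g (fn f x) := rfl

@[simp] theorem fn_id (X : FinTransRel) (x : X.carrier) : fn (𝟙 X) x = x := rfl

/-- A bijection that preserves and reflects the relations is an isomorphism. -/
theorem isIso_of_bijective {X Y : FinTransRel} (f : X ⟶ Y) (hf : Function.Bijective (fn f))
    (hrel : ∀ a b, Y.rel (fn f a) (fn f b) → X.rel a b) : IsIso f := by
  let e := Equiv.ofBijective _ hf
  have he : ∀ y, fn f (e.symm y) = y := e.apply_symm_apply
  refine ⟨homMk e.symm (fun a b h => hrel _ _ (by rwa [he, he])), ?_, ?_⟩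
  · ext x
    exact e.symm_apply_apply x
  · ext y
    exact he y

section Colimits

variable {J : Type} [SmallCategory J] [FinCategory J] (K : J ⥤ FinTransRel)

/-- The identifications made in the colimit of a diagram of finite transitive relations. -/
def colimitGlue (a b : Σ j, (K.obj j).carrier) : Prop :=
  ∃ f : a.1 ⟶ b.1, b.2 = fn (K.map f) a.2

/-- The relation carried over from the diagram to the quotient, before transitive closure. -/
def colimitStep (a b : Quot (colimitGlue K)) : Prop :=
  ∃ (j : J) (x y : (K.obj j).carrier), (K.obj j).rel x y ∧
    Quot.mk _ ⟨j, x⟩ = a ∧ Quot.mk _ ⟨j, y⟩ = b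

/-- The colimit of a finite diagram of finite transitive relations: the colimit of the underlying
sets, with the transitive closure of the image of the relations. -/
def colimitObj : FinTransRel where
  carrier := Quot (colimitGlue K)
  finite := by
    have : ∀ j, Finite (K.obj j).carrier := fun j => (K.obj j).finite
    infer_instance
  rel := Relation.TransGen (colimitStep K)
  trans := fun _ _ _ => Relation.TransGen.trans

/-- The colimit cocone on `colimitObj`. -/
def colimitCocone : Cocone K where
  pt := colimitObj K
  ι :=
    { app := fun j => homMk (Y := colimitObj K) (fun x => Quot.mk _ ⟨j, x⟩)
        (fun a b h => .single ⟨j, a, b, h, rfl, rfl⟩)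
      naturality := fun i j f => by
        ext x
        exact (Quot.sound ⟨f, rfl⟩ : Quot.mk (colimitGlue K) ⟨i, x⟩ = _).symm }

theorem colimitCocone_jointly_surjective (a : (colimitCocone K).pt.carrier) :
    ∃ (j : J) (x : (K.obj j).carrier), fn ((colimitCocone K).ι.app j) x = a := by
  obtain ⟨⟨j, x⟩, rfl⟩ := Quot.exists_rep a
  exact ⟨j, x, rfl⟩

/-- The colimit of a finite diagram has the universal property of a colimit with respect to all
transitive relations, including those on infinite sets in an arbitrary universe. -/
theorem colimitCocone_exists_desc {V : Type*} {R : V → V → Prop}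
    (hR : ∀ a b c, R a b → R b c → R a c) (h : ∀ j, (K.obj j).carrier → V)
    (hrel : ∀ j a b, (K.obj j).rel a b → R (h j a) (h j b))
    (hnat : ∀ {i j} (f : i ⟶ j) x, h j (fn (K.map f) x) = h i x) :
    ∃ g : (colimitCocone K).pt.carrier → V,
      (∀ a b, (colimitCocone K).pt.rel a b → R (g a) (g b)) ∧
      ∀ j x, g (fn ((colimitCocone K).ι.app j) x) = h j x := by
  refine ⟨Quot.lift (fun a => h a.1 a.2) ?_, ?_, fun j x => rfl⟩
  · rintro ⟨i, x⟩ ⟨j, y⟩ ⟨f, hf⟩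
    change h i x = h j y
    rw [show y = fn (K.map f) x from hf]
    exact (hnat f x).symm
  · intro a b hab
    induction hab with
    | single hab =>
      obtain ⟨j, x, y, hxy, rfl, rfl⟩ := hab
      exact hrel j x y hxy
    | tail _ hab ih =>
      obtain ⟨j, x, y, hxy, rfl, rfl⟩ := hab
      exact hR _ _ _ ih (hrel j x y hxy)

/-- The cocone `colimitCocone` is a colimit cocone. -/
noncomputable def colimitCoconeIsColimit : IsColimit (colimitCocone K) := by
  have key : ∀ s : Cocone K, ∃ g : (colimitCocone K).pt.carrier → s.pt.carrier,
      (∀ a b, (colimitCocone K).pt.rel a b → s.pt.rel (g a) (g b)) ∧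
      ∀ j x, g (fn ((colimitCocone K).ι.app j) x) = fn (s.ι.app j) x := fun s =>
    colimitCocone_exists_desc K s.pt.trans (fun j => fn (s.ι.app j))
      (fun j a b => rel_fn (s.ι.app j))
      (fun {i j} f x => by rw [← fn_comp, s.w f])
  choose g hg hfac using key
  exact
    { desc := fun s => homMk (g s) (hg s)
      fac := fun s j => by
        ext x
        exact hfac s j x
      uniq := fun s m hm => by
        ext a
        obtain ⟨j, x, rfl⟩ := colimitCocone_jointly_surjective K a
        rw [← fn_comp, hm, fn_homMk]
        exact (hfac s j x).symm }

end Colimits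

instance : HasFiniteColimits FinTransRel where
  out _ _ _ := ⟨fun K => ⟨⟨colimitCocone K, colimitCoconeIsColimit K⟩⟩⟩

end FinTransRel

/-! ### The embedding of ordinals into finite transitive relations -/

section Embedding

open FinTransRel

/-- A relation-preserving function between strict finite orders is a morphism of `L`. -/
def preimageHom {m n : L} (f : toFinTransRel.obj m ⟶ toFinTransRel.obj n) : m ⟶ n :=
  L.homMk (FinTransRel.fn f) (fun _ _ h => rel_fn f h)

@[simp] theorem map_preimageHom {m n : L} (f : toFinTransRel.obj m ⟶ toFinTransRel.obj n) :
    toFinTransRel.map (preimageHom f) = f := rfl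

instance : toFinTransRel.Full := ⟨fun f => ⟨preimageHom f, rfl⟩⟩

instance : toFinTransRel.Faithful :=
  ⟨fun h => L.hom_ext fun i => congrFun (congrArg FinTransRel.fn h) i⟩

/-- Counting the elements below a given one maps an irreflexive transitive relation on a finite set
into a finite ordinal. -/
theorem exists_strictMono_of_irrefl {X : Type} [Finite X] (r : X → X → Prop)
    (hirr : ∀ x, ¬ r x x) (htrans : ∀ a b c, r a b → r b c → r a c) :
    ∃ q : X → Fin (Nat.card X), ∀ a b, r a b → q a < q b := by
  classical
  have := Fintype.ofFinite X
  have hlt : ∀ x, (Finset.univ.filter (fun w => r w x)).card < Nat.card X := fun x => by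
    rw [Nat.card_eq_fintype_card]
    exact Finset.card_lt_univ_of_notMem (x := x) (by simpa using hirr x)
  refine ⟨fun x => ⟨_, hlt x⟩, fun a b hab => ?_⟩
  change Finset.card _ < Finset.card _
  refine Finset.card_lt_card ((Finset.ssubset_iff_of_subset ?_).2 ⟨a, ?_, ?_⟩)
  · intro w hw
    simp only [Finset.mem_filter, Finset.mem_univ, true_and] at hw ⊢
    exact htrans _ _ _ hw hab
  · simpa using hab
  · simpa using hirr a

/-- Two incomparable elements of a finite strict order can be put in any prescribed order by a
strictly monotone map into a finite ordinal. -/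
theorem exists_strictMono_of_incomparable {X : Type} [Finite X] (r : X → X → Prop)
    (hirr : ∀ x, ¬ r x x) (htrans : ∀ a b c, r a b → r b c → r a c) {x y : X} (hne : x ≠ y)
    (hxy : ¬ r x y) :
    ∃ q : X → Fin (Nat.card X), (∀ a b, r a b → q a < q b) ∧ q y < q x := by
  -- the order generated by `r` together with the pair `(y, x)`
  obtain ⟨q, hq⟩ := exists_strictMono_of_irrefl
    (fun a b => r a b ∨ ((r a y ∨ a = y) ∧ (r x b ∨ x = b)))
    (by
      rintro z (h | ⟨h | rfl, h' | rfl⟩)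
      · exact hirr z h
      · exact hxy (htrans _ _ _ h' h)
      · exact hxy h
      · exact hxy h'
      · exact hne rfl)
    (by
      rintro a b c (h | ⟨h, h'⟩) (k | ⟨k, k'⟩)
      · exact Or.inl (htrans _ _ _ h k)
      · refine Or.inr ⟨Or.inl ?_, k'⟩
        rcases k with k | rfl
        · exact htrans _ _ _ h k
        · exact h
      · refine Or.inr ⟨h, Or.inl ?_⟩
        rcases h' with h' | rfl
        · exact htrans _ _ _ h' k
        · exact k
      · exact Or.inr ⟨h, k'⟩)
  exact ⟨q, fun a b h => hq a b (Or.inl h), hq y x (Or.inr ⟨Or.inr rfl, Or.inr rfl⟩)⟩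

/-- If the ordinal `c` is the reflection of a finite transitive relation `X` into finite ordinals,
then `X` is isomorphic to `c`: any two elements have to be comparable, since incomparable ones can
be put in either order by maps into finite ordinals. -/
theorem isIso_of_reflection {X : FinTransRel} {c : L} (p : X ⟶ toFinTransRel.obj c)
    (hp : ∀ (n : L) (q : X ⟶ toFinTransRel.obj n), ∃ g : c ⟶ n, p ≫ toFinTransRel.map g = q) :
    IsIso p := by
  have := X.finite
  have hirr : ∀ x, ¬ X.rel x x := fun x h =>
    lt_irrefl (α := Fin c.len) _ (rel_fn p h)
  have hsep : ∀ x y : X.carrier, x ≠ y → ¬ X.rel x y →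
      (show Fin c.len from fn p y) < (show Fin c.len from fn p x) := by
    intro x y hne hxy
    obtain ⟨q, hq, hlt⟩ := exists_strictMono_of_incomparable X.rel hirr X.trans hne hxy
    obtain ⟨g, hg⟩ := hp ⟨Nat.card X.carrier⟩
      (homMk (Y := toFinTransRel.obj ⟨Nat.card X.carrier⟩) q hq)
    have hgq : ∀ z, L.fn g (fn p z) = q z := fun z => congrFun (congrArg fn hg) z
    rw [← hgq, ← hgq] at hlt
    exact (L.fn_strictMono g).lt_iff_lt.1 hlt
  have htri : ∀ x y : X.carrier, x ≠ y → X.rel x y ∨ X.rel y x := by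
    intro x y hne
    by_contra! h
    exact lt_asymm (hsep x y hne h.1) (hsep y x hne.symm h.2)
  -- As `X` is linear, counting predecessors is a bijection onto an ordinal; it factors through `p`
  -- by an injective map, which makes `p` surjective.
  obtain ⟨q, hq⟩ := exists_strictMono_of_irrefl X.rel hirr X.trans
  obtain ⟨g, hg⟩ := hp ⟨Nat.card X.carrier⟩
    (homMk (Y := toFinTransRel.obj ⟨Nat.card X.carrier⟩) q hq)
  have hgq : ∀ z, L.fn g (fn p z) = q z := fun z => congrFun (congrArg fn hg) z
  have hqinj : Function.Injective q := by
    intro x y hxy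
    by_contra hne
    rcases htri x y hne with h | h
    · exact (hq _ _ h).ne hxy
    · exact (hq _ _ h).ne hxy.symm
  have hqbij : Function.Bijective q :=
    (Nat.bijective_iff_injective_and_card q).2 ⟨hqinj, by simp⟩
  refine isIso_of_bijective p ⟨fun x y h => hqinj ?_, fun i => ?_⟩ fun a b h => ?_
  · rw [← hgq, ← hgq, h]
  · obtain ⟨x, hx⟩ := hqbij.2 (L.fn g i)
    exact ⟨x, (L.fn_strictMono g).injective ((hgq x).trans hx)⟩
  · by_contra hab
    by_cases hne : a = b
    · subst hne
      exact lt_irrefl (α := Fin c.len) _ h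
    · exact lt_asymm (α := Fin c.len) h (hsep a b hne hab)

/-- The finite colimits that exist in `L` are preserved by its embedding. -/
instance preservesFiniteColimits_toFinTransRel : PreservesFiniteColimits toFinTransRel where
  preservesFiniteColimits J _ _ := ⟨fun {K} => ⟨fun {c} hc => ⟨by
    let hX := colimitCoconeIsColimit (K ⋙ toFinTransRel)
    have : IsIso (hX.desc (toFinTransRel.mapCocone c)) := by
      refine isIso_of_reflection (c := c.pt) _ fun n q => ?_
      let s : Cocone K :=
        { pt := n
          ι :=
            { app := fun j => preimageHom ((colimitCocone (K ⋙ toFinTransRel)).ι.app j ≫ q)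
              naturality := fun i j f => toFinTransRel.map_injective (by
                simpa using (colimitCocone (K ⋙ toFinTransRel)).w_assoc f q) } }
      refine ⟨hc.desc s, hX.hom_ext fun j => ?_⟩
      rw [hX.fac_assoc]
      change toFinTransRel.map (c.ι.app j) ≫ _ = _
      rw [← toFinTransRel.map_comp, hc.fac]
      rfl
    exact IsColimit.ofPointIso hX⟩⟩⟩

end Embedding

/-! ### Gluing vertices and edges along a finite graph -/

/-- Let `σ τ : A ⟶ B` be the two endpoints of an "edge" `B`. Given a graph with vertices `V`,
edges `W`, and source and target functions `s` and `t`, the maps `p` and `q` exhibit `P` as the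
colimit of the diagram with a copy of `A` for each vertex and a copy of `B` for each edge. -/
structure IsGluing {C : Type*} [Category C] {A B P : C} (σ τ : A ⟶ B) {V W : Type} (s t : W → V)
    (p : V → (A ⟶ P)) (q : W → (B ⟶ P)) : Prop where
  src : ∀ w, σ ≫ q w = p (s w)
  tgt : ∀ w, τ ≫ q w = p (t w)
  exists_desc : ∀ {Q : C} (p' : V → (A ⟶ Q)) (q' : W → (B ⟶ Q)), (∀ w, σ ≫ q' w = p' (s w)) →
    (∀ w, τ ≫ q' w = p' (t w)) → ∃ h : P ⟶ Q, (∀ x, p x ≫ h = p' x) ∧ ∀ w, q w ≫ h = q' w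
  hom_ext : ∀ {Q : C} (h h' : P ⟶ Q), (∀ x, p x ≫ h = p x ≫ h') → (∀ w, q w ≫ h = q w ≫ h') →
    h = h'

section Diagram

variable {C : Type*} [Category C] {A B : C} (σ τ : A ⟶ B) {V W : Type} (s t : W → V)

/-- The diagram with a copy of `A` for each vertex and a copy of `B` for each edge of a graph. -/
def gluingDiagram : WalkingMulticospan ⟨V, W, s, t⟩ ⥤ C :=
  MulticospanIndex.multicospan
    { left := fun _ => A
      right := fun _ => B
      fst := fun _ => σ
      snd := fun _ => τ }

/-- A cocone on the composite of a gluing diagram with a functor, from its components. -/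
def gluingCocone {D : Type*} [Category D] (F : C ⥤ D) {Q : D} (p : V → (F.obj A ⟶ Q))
    (q : W → (F.obj B ⟶ Q)) (hs : ∀ w, F.map σ ≫ q w = p (s w))
    (ht : ∀ w, F.map τ ≫ q w = p (t w)) : Cocone (gluingDiagram σ τ s t ⋙ F) where
  pt := Q
  ι :=
    { app := fun j => match j with
        | .left x => p x
        | .right w => q w
      naturality := by
        rintro _ _ (_ | w | w)
        · rw [WalkingMulticospan.Hom.id_eq_id, CategoryTheory.Functor.map_id,
            CategoryTheory.Functor.map_id, Category.id_comp, Category.comp_id]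
        · exact (hs w).trans (Category.comp_id _).symm
        · exact (ht w).trans (Category.comp_id _).symm }

theorem isGluing_map_of_isColimit {D : Type*} [Category D] (F : C ⥤ D)
    {c : Cocone (gluingDiagram σ τ s t)} (hc : IsColimit (F.mapCocone c)) :
    IsGluing (F.map σ) (F.map τ) s t (fun x => F.map (c.ι.app (.left x)))
      (fun w => F.map (c.ι.app (.right w))) where
  src w := (F.mapCocone c).w (WalkingMulticospan.Hom.fst (J := ⟨V, W, s, t⟩) w)
  tgt w := (F.mapCocone c).w (WalkingMulticospan.Hom.snd (J := ⟨V, W, s, t⟩) w)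
  exists_desc p' q' hs ht :=
    ⟨hc.desc (gluingCocone σ τ s t F p' q' hs ht), fun x => hc.fac _ (.left x),
      fun w => hc.fac _ (.right w)⟩
  hom_ext _ _ hp hq := hc.hom_ext fun j => match j with
    | .left x => hp x
    | .right w => hq w

/-- A category with finite colimits has all gluings along finite graphs. -/
theorem exists_isGluing [HasFiniteColimits C] [Finite V] [Finite W] :
    ∃ (P : C) (p : V → (A ⟶ P)) (q : W → (B ⟶ P)), IsGluing σ τ s t p q := by
  classical
  have := Fintype.ofFinite V
  have := Fintype.ofFinite W
  exact ⟨_, _, _, isGluing_map_of_isColimit σ τ s t (𝟭 C)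
    (isColimitOfPreserves (𝟭 C) (colimit.isColimit (gluingDiagram σ τ s t)))⟩

variable {σ τ s t}

/-- Functors preserving finite colimits preserve gluings along finite graphs. -/
theorem IsGluing.map {D : Type*} [Category D] (F : C ⥤ D) [PreservesFiniteColimits F]
    [Finite V] [Finite W] {P : C} {p : V → (A ⟶ P)} {q : W → (B ⟶ P)}
    (h : IsGluing σ τ s t p q) :
    IsGluing (F.map σ) (F.map τ) s t (fun x => F.map (p x)) (fun w => F.map (q w)) := by
  classical
  have := Fintype.ofFinite V
  have := Fintype.ofFinite W
  let c : Cocone (gluingDiagram σ τ s t) := gluingCocone σ τ s t (𝟭 C) p q h.src h.tgt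
  have key : ∀ d : Cocone (gluingDiagram σ τ s t), ∃ g : P ⟶ d.pt,
      (∀ x, p x ≫ g = d.ι.app (.left x)) ∧ ∀ w, q w ≫ g = d.ι.app (.right w) := fun d =>
    h.exists_desc _ _
      (fun w => d.w (WalkingMulticospan.Hom.fst (J := ⟨V, W, s, t⟩) w))
      (fun w => d.w (WalkingMulticospan.Hom.snd (J := ⟨V, W, s, t⟩) w))
  choose g hg using key
  have hc : IsColimit c :=
    { desc := g
      fac := fun d j => match j with
        | .left x => (hg d).1 x
        | .right w => (hg d).2 w
      uniq := fun d m hm => h.hom_ext _ _ (fun x => (hm (.left x)).trans ((hg d).1 x).symm)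
        (fun w => (hm (.right w)).trans ((hg d).2 w).symm) }
  exact isGluing_map_of_isColimit σ τ s t F (isColimitOfPreserves F hc)

end Diagram

/-! ### Vertices and edges of ordinals and of finite transitive relations -/

/-- The vertex `i` of the ordinal `n`. -/
def L.vert {n : L} (i : Fin n.len) : (⟨1⟩ : L) ⟶ n :=
  L.homMk (m := ⟨1⟩) (fun _ => i) (fun a b h => absurd h (by simp [Subsingleton.elim a b]))

/-- The edge from `i` to `j` of the ordinal `n`. -/
def L.edge {n : L} {i j : Fin n.len} (h : i < j) : (⟨2⟩ : L) ⟶ n :=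
  L.homMk (m := ⟨2⟩) ![i, j] (by
    intro a b hab
    fin_cases a <;> fin_cases b <;> simp_all)

/-- The source of the generic edge. -/
def L.source : (⟨1⟩ : L) ⟶ ⟨2⟩ := L.vert (n := ⟨2⟩) (0 : Fin 2)

/-- The target of the generic edge. -/
def L.target : (⟨1⟩ : L) ⟶ ⟨2⟩ := L.vert (n := ⟨2⟩) (1 : Fin 2)

theorem L.vert_comp {m n : L} (i : Fin m.len) (f : m ⟶ n) : L.vert i ≫ f = L.vert (L.fn f i) :=
  rfl

theorem L.source_edge {n : L} {i j : Fin n.len} (h : i < j) :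
    L.source ≫ L.edge h = L.vert i := rfl

theorem L.target_edge {n : L} {i j : Fin n.len} (h : i < j) :
    L.target ≫ L.edge h = L.vert j := rfl

theorem L.vert_injective {n : L} {i j : Fin n.len} (h : L.vert i = L.vert j) : i = j :=
  congrArg (fun f : (⟨1⟩ : L) ⟶ n => L.fn f (0 : Fin 1)) h

theorem L.vert_fn_zero {n : L} (f : (⟨1⟩ : L) ⟶ n) : L.vert (L.fn f (0 : Fin 1)) = f :=
  L.hom_ext (m := ⟨1⟩) fun i => by
    rw [show i = (0 : Fin 1) from Subsingleton.elim (α := Fin 1) _ _]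
    rfl

theorem L.edge_hom_ext {n : L} {f g : (⟨2⟩ : L) ⟶ n} (h0 : L.source ≫ f = L.source ≫ g)
    (h1 : L.target ≫ f = L.target ≫ g) : f = g := by
  refine L.hom_ext fun i => ?_
  change Fin 2 at i
  fin_cases i
  · exact L.vert_injective h0
  · exact L.vert_injective h1

/-- The ordinal `n` is a gluing in `L` along any graph on its vertices whose edges go upwards and
suffice to detect strictly monotone functions. -/
theorem L.isGluing {n : L} {W : Type} (s t : W → Fin n.len) (hst : ∀ w, s w < t w)
    (hmono : ∀ (m : L) (f : Fin n.len → Fin m.len), (∀ w, f (s w) < f (t w)) → StrictMono f) :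
    IsGluing L.source L.target s t L.vert (fun w => L.edge (hst w)) where
  src _ := rfl
  tgt _ := rfl
  exists_desc {Q} p' q' hs ht := by
    let f : Fin n.len → Fin Q.len := fun i => L.fn (p' i) (0 : Fin 1)
    have hp : ∀ i, L.vert (f i) = p' i := fun i => L.vert_fn_zero _
    have hf : StrictMono f := hmono Q f fun w => by
      have h0 : f (s w) = L.fn (q' w) (0 : Fin 2) := L.vert_injective ((hp _).trans (hs w).symm)
      have h1 : f (t w) = L.fn (q' w) (1 : Fin 2) := L.vert_injective ((hp _).trans (ht w).symm)
      rw [h0, h1]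
      exact L.fn_strictMono _ (by decide : (0 : Fin 2) < 1)
    refine ⟨L.homMk f hf, hp, fun w => L.edge_hom_ext ?_ ?_⟩
    · exact (hp _).trans (hs w).symm
    · exact (hp _).trans (ht w).symm
  hom_ext h h' hp _ := L.hom_ext fun i => L.vert_injective (hp i)

namespace FinTransRel

variable {X Y : FinTransRel}

/-- An element of `X`, as a morphism from `1`. -/
def vert (x : X.carrier) : toFinTransRel.obj ⟨1⟩ ⟶ X :=
  homMk (X := toFinTransRel.obj ⟨1⟩) (fun _ => x)
    (fun a b h => absurd (show (show Fin 1 from a) < b from h)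
      (Subsingleton.elim (α := Fin 1) a b).not_lt)

/-- A pair of related elements of `X`, as a morphism from `2`. -/
def edge {x y : X.carrier} (h : X.rel x y) : toFinTransRel.obj ⟨2⟩ ⟶ X :=
  homMk (X := toFinTransRel.obj ⟨2⟩) (![x, y] : Fin 2 → X.carrier) (by
    intro a b hab
    change Fin 2 at a b
    change a < b at hab
    fin_cases a <;> fin_cases b <;> first | exact h | simp at hab)

theorem vert_comp (x : X.carrier) (f : X ⟶ Y) : vert x ≫ f = vert (fn f x) := rfl

theorem vert_injective {x y : X.carrier} (h : vert x = vert y) : x = y :=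
  congrArg (fun f : toFinTransRel.obj ⟨1⟩ ⟶ X => fn f (0 : Fin 1)) h

theorem vert_fn_zero (f : toFinTransRel.obj ⟨1⟩ ⟶ X) : vert (fn f (0 : Fin 1)) = f :=
  hom_ext (X := toFinTransRel.obj ⟨1⟩) fun i => by
    rw [show i = (0 : Fin 1) from Subsingleton.elim (α := Fin 1) _ _]
    rfl

theorem source_edge {x y : X.carrier} (h : X.rel x y) :
    toFinTransRel.map L.source ≫ edge h = vert x := rfl

theorem target_edge {x y : X.carrier} (h : X.rel x y) :
    toFinTransRel.map L.target ≫ edge h = vert y := rfl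

theorem edge_hom_ext {f g : toFinTransRel.obj ⟨2⟩ ⟶ X}
    (h0 : toFinTransRel.map L.source ≫ f = toFinTransRel.map L.source ≫ g)
    (h1 : toFinTransRel.map L.target ≫ f = toFinTransRel.map L.target ≫ g) : f = g := by
  refine hom_ext fun i => ?_
  change Fin 2 at i
  fin_cases i
  · exact vert_injective h0
  · exact vert_injective h1

/-- A finite transitive relation is the gluing of its elements along its related pairs. -/
theorem isGluing (X : FinTransRel) :
    IsGluing (toFinTransRel.map L.source) (toFinTransRel.map L.target)
      (fun w : {w : X.carrier × X.carrier // X.rel w.1 w.2} => w.1.1) (fun w => w.1.2)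
      vert (fun w => edge w.2) where
  src _ := rfl
  tgt _ := rfl
  exists_desc {Q} p' q' hs ht := by
    let f : X.carrier → Q.carrier := fun x => fn (p' x) (0 : Fin 1)
    have hp : ∀ x, vert (f x) = p' x := fun x => vert_fn_zero _
    have hf : ∀ a b, X.rel a b → Q.rel (f a) (f b) := fun a b hab => by
      have h0 : f a = fn (q' ⟨(a, b), hab⟩) (0 : Fin 2) :=
        vert_injective ((hp _).trans (hs ⟨(a, b), hab⟩).symm)
      have h1 : f b = fn (q' ⟨(a, b), hab⟩) (1 : Fin 2) :=
        vert_injective ((hp _).trans (ht ⟨(a, b), hab⟩).symm)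
      rw [h0, h1]
      exact rel_fn (X := toFinTransRel.obj ⟨2⟩) _ (by decide : (0 : Fin 2) < 1)
    refine ⟨homMk f hf, hp, fun w => edge_hom_ext ?_ ?_⟩
    · exact (hp _).trans (hs w).symm
    · exact (hp _).trans (ht w).symm
  hom_ext h h' hp _ := hom_ext fun x => vert_injective (hp x)

end FinTransRel

/-! ### The transitive relation on the vertices of an object -/

section Extension

variable {E : Type u} [Category.{v} E] (F : L ⥤ E)

/-- For a functor `F : L ⥤ E`, the morphisms `F 1 ⟶ Q` are the vertices of `Q`; two of them are
related when they are the endpoints of an edge `F 2 ⟶ Q`. -/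
def vertexHomRel {Q : E} (a b : F.obj ⟨1⟩ ⟶ Q) : Prop :=
  ∃ q : F.obj ⟨2⟩ ⟶ Q, F.map L.source ≫ q = a ∧ F.map L.target ≫ q = b

variable {F}

theorem vertexHomRel.comp {Q Q' : E} {a b : F.obj ⟨1⟩ ⟶ Q} (h : vertexHomRel F a b) (g : Q ⟶ Q') :
    vertexHomRel F (a ≫ g) (b ≫ g) := by
  obtain ⟨q, rfl, rfl⟩ := h
  exact ⟨q ≫ g, by simp, by simp⟩

theorem vertexHomRel_vert {n : L} {i j : Fin n.len} (h : i < j) :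
    vertexHomRel F (F.map (L.vert i)) (F.map (L.vert j)) :=
  ⟨F.map (L.edge h), by rw [← F.map_comp, L.source_edge], by rw [← F.map_comp, L.target_edge]⟩

variable [PreservesFiniteColimits F]

/-- There is at most one edge between two vertices: in `L`, gluing two copies of `2` along their
endpoints yields `2` again. -/
theorem edgeHom_ext {Q : E} {q q' : F.obj ⟨2⟩ ⟶ Q} (h0 : F.map L.source ≫ q = F.map L.source ≫ q')
    (h1 : F.map L.target ≫ q = F.map L.target ≫ q') : q = q' := by
  have h01 : (0 : Fin 2) < 1 := by decide
  have hg := (L.isGluing (n := ⟨2⟩) (W := Bool) (fun _ => (0 : Fin 2)) (fun _ => (1 : Fin 2))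
    (fun _ => h01) (fun m f hf a b hab => by
      change Fin 2 at a b
      fin_cases a <;> fin_cases b <;>
        first | exact hf true | simp at hab)).map F
  obtain ⟨h, -, hh⟩ := hg.exists_desc (Q := Q)
    ((![F.map L.source ≫ q, F.map L.target ≫ q] : Fin 2 → (F.obj ⟨1⟩ ⟶ Q)))
    (fun b => cond b q q')
    (by rintro (_ | _) <;> simp [h0]) (by rintro (_ | _) <;> simp [h1])
  have ht := hh true
  have hf := hh false
  exact ht.symm.trans hf

/-- The relation on vertices is transitive: in `L`, gluing two copies of `2` end to end yields `3`,
which has an edge from its first to its last vertex. -/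
theorem vertexHomRel_trans {Q : E} (a b c : F.obj ⟨1⟩ ⟶ Q) (hab : vertexHomRel F a b)
    (hbc : vertexHomRel F b c) : vertexHomRel F a c := by
  obtain ⟨q, hq0, hq1⟩ := hab
  obtain ⟨q', hq0', hq1'⟩ := hbc
  have hg := (L.isGluing (n := ⟨3⟩) (W := Fin 2) (fun w => w.castSucc) (fun w => w.succ)
    (fun w => Fin.castSucc_lt_succ) (fun m f hf => Fin.strictMono_iff_lt_succ.2 hf)).map F
  obtain ⟨h, hv, -⟩ := hg.exists_desc (Q := Q) (![a, b, c] : Fin 3 → (F.obj ⟨1⟩ ⟶ Q)) ![q, q']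
    (by intro w; fin_cases w <;> simpa) (by intro w; fin_cases w <;> simpa)
  have h02 := (vertexHomRel_vert (F := F) (n := ⟨3⟩) (i := (0 : Fin 3)) (j := (2 : Fin 3))
    (by decide)).comp h
  have h0 : F.map (L.vert (n := ⟨3⟩) (0 : Fin 3)) ≫ h = a := hv (0 : Fin 3)
  have h2 : F.map (L.vert (n := ⟨3⟩) (2 : Fin 3)) ≫ h = c := hv (2 : Fin 3)
  rwa [h0, h2] at h02

end Extension

/-! ### The extension of a conservative functor -/

section Extension

variable {E : Type u} [Category.{v} E]

/-- The object `T`, with the vertices `η`, represents the relation-preserving maps from `X` to the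
vertices of objects of `E`. -/
structure IsRealization (F : L ⥤ E) (X : FinTransRel) (T : E)
    (η : X.carrier → (F.obj ⟨1⟩ ⟶ T)) : Prop where
  rel : ∀ x y, X.rel x y → vertexHomRel F (η x) (η y)
  exists_desc : ∀ {Q : E} (h : X.carrier → (F.obj ⟨1⟩ ⟶ Q)),
    (∀ x y, X.rel x y → vertexHomRel F (h x) (h y)) → ∃ g : T ⟶ Q, ∀ x, η x ≫ g = h x
  hom_ext : ∀ {Q : E} (g g' : T ⟶ Q), (∀ x, η x ≫ g = η x ≫ g') → g = g'

variable (F : L ⥤ E) [PreservesFiniteColimits F]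

variable {F} in
/-- Since there is at most one edge between two vertices, gluing vertices and edges along `X`
realizes `X`. -/
theorem IsGluing.isRealization {X : FinTransRel} {T : E} {η : X.carrier → (F.obj ⟨1⟩ ⟶ T)}
    {q : {w : X.carrier × X.carrier // X.rel w.1 w.2} → (F.obj ⟨2⟩ ⟶ T)}
    (h : IsGluing (F.map L.source) (F.map L.target) (fun w => w.1.1) (fun w => w.1.2) η q) :
    IsRealization F X T η where
  rel x y hxy := ⟨q ⟨(x, y), hxy⟩, h.src _, h.tgt _⟩
  exists_desc p' hp' := by
    choose q' hs ht using fun w : {w : X.carrier × X.carrier // X.rel w.1 w.2} => hp' _ _ w.2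
    obtain ⟨g, hg, -⟩ := h.exists_desc p' q' hs ht
    exact ⟨g, hg⟩
  hom_ext g g' hg := h.hom_ext g g' hg fun w => edgeHom_ext
    (by rw [← Category.assoc, ← Category.assoc, h.src, hg])
    (by rw [← Category.assoc, ← Category.assoc, h.tgt, hg])

theorem exists_isRealization [HasFiniteColimits E] (X : FinTransRel) :
    ∃ (T : E) (η : X.carrier → (F.obj ⟨1⟩ ⟶ T)), IsRealization F X T η := by
  have := X.finite
  obtain ⟨T, η, q, h⟩ := exists_isGluing (F.map L.source) (F.map L.target)
    (fun w : {w : X.carrier × X.carrier // X.rel w.1 w.2} => w.1.1) (fun w => w.1.2)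
  exact ⟨T, η, h.isRealization⟩

/-- The object `F n` realizes the ordinal `n`, as `n` is glued in `L` from its vertices and
edges. -/
theorem isRealization_obj (n : L) :
    IsRealization F (toFinTransRel.obj n) (F.obj n) (fun i => F.map (L.vert i)) :=
  ((L.isGluing (n := n) (W := {w : Fin n.len × Fin n.len // w.1 < w.2}) (fun w => w.1.1)
    (fun w => w.1.2) (fun w => w.2) (fun _ _ hf a b hab => hf ⟨(a, b), hab⟩)).map F).isRealization

/-- A functor on finite transitive relations preserving finite colimits realizes every `X` from its
restriction to `L`. -/
theorem isRealization_of_preserves (G : FinTransRel ⥤ E) [PreservesFiniteColimits G]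
    (X : FinTransRel) :
    IsRealization (toFinTransRel ⋙ G) X (G.obj X) (fun x => G.map (FinTransRel.vert x)) := by
  have := X.finite
  exact ((FinTransRel.isGluing X).map G).isRealization (F := toFinTransRel ⋙ G)

section

variable [HasFiniteColimits E]

/-- A chosen realization of `X` in `E`. -/
noncomputable def realization (X : FinTransRel) : E := (exists_isRealization F X).choose

/-- The vertices of the chosen realization of `X`. -/
noncomputable def realizationVert (X : FinTransRel) (x : X.carrier) :
    F.obj ⟨1⟩ ⟶ realization F X :=
  (exists_isRealization F X).choose_spec.choose x

theorem isRealization_realization (X : FinTransRel) :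
    IsRealization F X (realization F X) (realizationVert F X) :=
  (exists_isRealization F X).choose_spec.choose_spec

theorem exists_realizationMap {X Y : FinTransRel} (f : X ⟶ Y) :
    ∃ g : realization F X ⟶ realization F Y,
      ∀ x, realizationVert F X x ≫ g = realizationVert F Y (FinTransRel.fn f x) :=
  (isRealization_realization F X).exists_desc _ fun _ _ h =>
    (isRealization_realization F Y).rel _ _ (FinTransRel.rel_fn f h)

/-- The morphism between realizations induced by a morphism of finite transitive relations. -/
noncomputable def realizationMap {X Y : FinTransRel} (f : X ⟶ Y) :
    realization F X ⟶ realization F Y :=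
  (exists_realizationMap F f).choose

@[simp] theorem realizationVert_map {X Y : FinTransRel} (f : X ⟶ Y) (x : X.carrier) :
    realizationVert F X x ≫ realizationMap F f = realizationVert F Y (FinTransRel.fn f x) :=
  (exists_realizationMap F f).choose_spec x

@[simp] theorem realizationVert_map_assoc {X Y : FinTransRel} (f : X ⟶ Y) (x : X.carrier) {Q : E}
    (g : realization F Y ⟶ Q) :
    realizationVert F X x ≫ realizationMap F f ≫ g =
      realizationVert F Y (FinTransRel.fn f x) ≫ g := by
  rw [← Category.assoc, realizationVert_map]

/-- The extension of a conservative functor on `L` to finite transitive relations. -/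
noncomputable def extension : FinTransRel ⥤ E where
  obj := realization F
  map := realizationMap F
  map_id X := (isRealization_realization F X).hom_ext _ _ fun x => by simp
  map_comp {X _ _} f g := (isRealization_realization F X).hom_ext _ _ fun x => by simp

/-- The realization of the ordinal `n` is `F n`. -/
theorem exists_realizationIso (n : L) : ∃ e : realization F (toFinTransRel.obj n) ≅ F.obj n,
    ∀ i, realizationVert F (toFinTransRel.obj n) i ≫ e.hom = F.map (L.vert i) := by
  have h := isRealization_realization F (toFinTransRel.obj n)
  have h' := isRealization_obj F n
  obtain ⟨g, hg⟩ := h.exists_desc _ h'.rel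
  obtain ⟨g', hg'⟩ := h'.exists_desc _ h.rel
  refine ⟨⟨g, g', h.hom_ext _ _ fun x => ?_, h'.hom_ext _ _ fun x => ?_⟩, hg⟩
  · exact (Category.assoc _ _ _).symm.trans
      ((congrArg (· ≫ g') (hg x)).trans ((hg' x).trans (Category.comp_id _).symm))
  · exact (Category.assoc _ _ _).symm.trans
      ((congrArg (· ≫ g) (hg' x)).trans ((hg x).trans (Category.comp_id _).symm))

/-- The extension of a conservative functor restricts to it on `L`. -/
noncomputable def extensionIso : toFinTransRel ⋙ extension F ≅ F :=
  NatIso.ofComponents (fun n => (exists_realizationIso F n).choose) fun {m n} f =>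
    (isRealization_realization F (toFinTransRel.obj m)).hom_ext _ _ fun i => by
      have hm := (exists_realizationIso F m).choose_spec i
      have hn := (exists_realizationIso F n).choose_spec (L.fn f i)
      calc
        _ = realizationVert F (toFinTransRel.obj n) (L.fn f i) ≫
            (exists_realizationIso F n).choose.hom :=
          realizationVert_map_assoc F (toFinTransRel.map f) i _
        _ = F.map (L.vert i) ≫ F.map f := hn.trans (F.map_comp (L.vert i) f)
        _ = (realizationVert F (toFinTransRel.obj m) i ≫
            (exists_realizationIso F m).choose.hom) ≫ F.map f := by rw [hm]
        _ = _ := Category.assoc _ _ _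

/-- The extension preserves finite colimits: the vertices of an object of `E` form a transitive
relation, possibly on an infinite set, and colimits of finite transitive relations have the
universal property for all of these. -/
instance preservesFiniteColimits_extension : PreservesFiniteColimits (extension F) where
  preservesFiniteColimits _ _ _ := ⟨fun {K} =>
    preservesColimit_of_preserves_colimit_cocone (FinTransRel.colimitCoconeIsColimit K) (by
      have hr := fun X => isRealization_realization F X
      have key : ∀ s : Cocone (K ⋙ extension F),
          ∃ g : realization F (FinTransRel.colimitCocone K).pt ⟶ s.pt,
          ∀ j, realizationMap F ((FinTransRel.colimitCocone K).ι.app j) ≫ g = s.ι.app j := by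
        intro s
        obtain ⟨h, hrel, hh⟩ := FinTransRel.colimitCocone_exists_desc K
          (R := vertexHomRel F (Q := s.pt)) vertexHomRel_trans
          (fun j x => realizationVert F (K.obj j) x ≫ s.ι.app j)
          (fun j a b hab => ((hr _).rel a b hab).comp _)
          (fun {i j} f x => by
            rw [← s.w f]
            exact (realizationVert_map_assoc F (K.map f) x _).symm)
        obtain ⟨g, hg⟩ := (hr (FinTransRel.colimitCocone K).pt).exists_desc h hrel
        exact ⟨g, fun j => (hr _).hom_ext _ _ fun x =>
          (realizationVert_map_assoc F _ x g).trans ((hg _).trans (hh j x))⟩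
      choose g hg using key
      exact
        { desc := g
          fac := hg
          uniq := fun s m hm => (hr _).hom_ext _ _ fun a => by
            obtain ⟨j, x, rfl⟩ := FinTransRel.colimitCocone_jointly_surjective K a
            have h := (hm j).trans (hg s j).symm
            exact (realizationVert_map_assoc F _ x m).symm.trans
              ((congrArg (realizationVert F (K.obj j) x ≫ ·) h).trans
                (realizationVert_map_assoc F _ x (g s))) })⟩

end

end Extension

/-! ### Uniqueness of the extension -/

/-- A functor preserving finite colimits is determined by its restriction to `L`, as are the
natural transformations out of it. -/
theorem whiskerLeft_toFinTransRel_bijective {E : Type u} [Category.{v} E] (G : FinTransRel ⥤ E)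
    [PreservesFiniteColimits G] (H : FinTransRel ⥤ E) :
    Function.Bijective
      (fun γ : G ⟶ H => (Functor.whiskerLeft toFinTransRel γ : toFinTransRel ⋙ G ⟶ _)) := by
  have hr := isRealization_of_preserves G
  constructor
  · intro γ γ' h
    ext X
    refine (hr X).hom_ext _ _ fun x => ?_
    have h1 : γ.app (toFinTransRel.obj ⟨1⟩) = γ'.app (toFinTransRel.obj ⟨1⟩) :=
      congrArg (fun θ => NatTrans.app θ (⟨1⟩ : L)) h
    rw [γ.naturality, γ'.naturality, h1]
  · intro θ
    have key : ∀ X, ∃ g : G.obj X ⟶ H.obj X, ∀ x,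
        G.map (FinTransRel.vert x) ≫ g = θ.app ⟨1⟩ ≫ H.map (FinTransRel.vert x) := fun X =>
      (hr X).exists_desc (fun x => θ.app ⟨1⟩ ≫ H.map (FinTransRel.vert x)) fun x y h =>
        ⟨θ.app ⟨2⟩ ≫ H.map (FinTransRel.edge h), by
          rw [θ.naturality_assoc, Functor.comp_map, ← H.map_comp, FinTransRel.source_edge], by
          rw [θ.naturality_assoc, Functor.comp_map, ← H.map_comp, FinTransRel.target_edge]⟩
    choose g hg using key
    refine ⟨{ app := g, naturality := fun X Y f => (hr X).hom_ext _ _ fun x => ?_ }, ?_⟩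
    · rw [reassoc_of% (hg X x), ← G.map_comp_assoc, ← H.map_comp, FinTransRel.vert_comp, hg]
    · ext n
      refine (hr (toFinTransRel.obj n)).hom_ext _ _ fun i => ?_
      exact (hg _ i).trans (θ.naturality (L.vert i)).symm

/-! ### Graphs with unique edges along paths as transitive relations -/

/-- An edge is a path of length one, so there is at most one edge between two vertices. -/
theorem TransGraph.edge_ext (Q : TransGraph) {e e' : Q.obj.E} (hs : Q.obj.src e = Q.obj.src e')
    (ht : Q.obj.tgt e = Q.obj.tgt e') : e = e' :=
  (Q.property.2.2 1 (Q.obj.src e) (Q.obj.tgt e) one_pos (.cons (.nil _) e rfl)).unique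
    ⟨rfl, rfl⟩ ⟨hs.symm, ht.symm⟩

theorem G.eq_one_or_eq_two (g : G) : g = G.one ∨ g = G.two := by
  obtain ⟨⟨n⟩, h⟩ := g
  rcases h with h | h <;> change n = _ at h <;> subst h
  · exact Or.inl rfl
  · exact Or.inr rfl

theorem G.one_hom_eq_id (h : G.one ⟶ G.one) : h = 𝟙 _ := by
  refine oneTwo.hom_ext (L.hom_ext fun i => ?_)
  exact Subsingleton.elim (α := Fin 1) _ _

theorem G.eq_pt (h : G.one ⟶ G.two) : h = G.pt 0 ∨ h = G.pt 1 := by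
  have key : ∀ j : Fin 2, L.fn h.hom (0 : Fin 1) = j → h = G.pt j := fun j hj => by
    refine oneTwo.hom_ext (L.hom_ext fun i => ?_)
    rw [show i = (0 : Fin 1) from Subsingleton.elim (α := Fin 1) _ _]
    exact hj
  have h2 : ∀ j : Fin 2, j = 0 ∨ j = 1 := by decide
  exact (h2 (L.fn h.hom (0 : Fin 1))).imp (key 0) (key 1)

/-- The cells of a graph in `TransGraph` are determined by their vertices. -/
theorem TransGraph.cell_ext (Q : TransGraph) {g : G} {q q' : Q.obj.obj (Opposite.op g)}
    (h : ∀ f : G.one ⟶ g, Q.obj.map f.op q = Q.obj.map f.op q') : q = q' := by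
  rcases G.eq_one_or_eq_two g with rfl | rfl
  · simpa using h (𝟙 _)
  · exact TransGraph.edge_ext Q (h (G.pt 0)) (h (G.pt 1))

/-- A relation-preserving function on vertices extends to all cells: a related pair of vertices is
joined by an edge. -/
theorem TransGraph.exists_cell {P Q : TransGraph} (φ : vertexRel.obj P ⟶ vertexRel.obj Q) {g : G}
    (p : P.obj.obj (Opposite.op g)) : ∃ q : Q.obj.obj (Opposite.op g), ∀ f : G.one ⟶ g,
      Q.obj.map f.op q = FinTransRel.fn φ (P.obj.map f.op p : P.obj.V) := by
  rcases G.eq_one_or_eq_two g with rfl | rfl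
  · refine ⟨FinTransRel.fn φ (p : P.obj.V), fun f => ?_⟩
    rw [G.one_hom_eq_id f, op_id, Q.obj.map_id, P.obj.map_id]
    rfl
  · obtain ⟨q, hs, ht⟩ := FinTransRel.rel_fn φ
      (a := P.obj.src p) (b := P.obj.tgt p) ⟨p, rfl, rfl⟩
    refine ⟨q, fun f => ?_⟩
    rcases G.eq_pt f with rfl | rfl
    · exact hs
    · exact ht

instance : vertexRel.Faithful where
  map_injective {P Q f f'} h := by
    refine finTransitive.hom_ext (NatTrans.ext (funext fun g => ?_))
    ext p
    refine TransGraph.cell_ext Q fun k => ?_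
    exact (NatTrans.naturality_apply f.hom k.op p).symm.trans
      ((congrFun (congrArg FinTransRel.fn h) _).trans (NatTrans.naturality_apply f'.hom k.op p))

instance : vertexRel.Full where
  map_surjective {P Q} φ := by
    choose q hq using fun (g : G) (p : P.obj.obj (Opposite.op g)) => TransGraph.exists_cell φ p
    refine ⟨ObjectProperty.homMk
      { app := fun g => TypeCat.ofHom (q g.unop), naturality := fun g g' k => ?_ }, ?_⟩
    · ext p
      refine TransGraph.cell_ext Q fun f => (hq g'.unop (P.obj.map k p) f).trans ?_
      have h := hq g.unop p (f ≫ k.unop)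
      rw [op_comp, Functor.map_comp_apply, Functor.map_comp_apply] at h
      exact h.symm
    · ext x
      have h := hq G.one x (𝟙 _)
      rw [op_id, Q.obj.map_id, P.obj.map_id] at h
      exact h

/-- The graph of vertices and edges of a finite transitive relation. -/
def FinTransRel.toGraph (X : FinTransRel) : Graph :=
  (oneTwo.ι ⋙ toFinTransRel).op ⋙ yoneda.obj X

namespace FinTransRel

variable {X : FinTransRel}

/-- The element of `X` named by a vertex of its graph. -/
def vertexVal (x : X.toGraph.V) : X.carrier :=
  fn (X := toFinTransRel.obj ⟨1⟩) x (0 : Fin 1)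

theorem vertexVal_bijective : Function.Bijective (vertexVal (X := X)) :=
  ⟨fun x y h => (vert_fn_zero (X := X) x).symm.trans
    ((congrArg vert h).trans (vert_fn_zero (X := X) y)), fun x => ⟨vert x, rfl⟩⟩

theorem toGraph_edge_iff {x y : X.toGraph.V} :
    (∃ e : X.toGraph.E, X.toGraph.src e = x ∧ X.toGraph.tgt e = y) ↔
      X.rel (vertexVal x) (vertexVal y) := by
  constructor
  · rintro ⟨e, rfl, rfl⟩
    exact rel_fn (X := toFinTransRel.obj ⟨2⟩) e (by decide : (0 : Fin 2) < 1)
  · intro h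
    exact ⟨edge h, vertexVal_bijective.1 rfl, vertexVal_bijective.1 rfl⟩

theorem toGraph_edge_ext {e e' : X.toGraph.E} (hs : X.toGraph.src e = X.toGraph.src e')
    (ht : X.toGraph.tgt e = X.toGraph.tgt e') : e = e' :=
  edge_hom_ext (X := X) hs ht

theorem rel_of_hasPath {k : ℕ} {x y : X.toGraph.V} (h : X.toGraph.HasPath k x y) :
    (k = 0 ∧ x = y) ∨ X.rel (vertexVal x) (vertexVal y) := by
  induction h with
  | nil => exact Or.inl ⟨rfl, rfl⟩
  | cons h e he ih =>
    have h1 := toGraph_edge_iff.1 ⟨e, he, rfl⟩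
    rcases ih with ⟨-, rfl⟩ | ih
    · exact Or.inr h1
    · exact Or.inr (X.trans _ _ _ ih h1)

theorem finTransitive_toGraph (X : FinTransRel) : finTransitive X.toGraph := by
  have := X.finite
  have hV : Finite X.toGraph.V := Finite.of_injective _ vertexVal_bijective.1
  refine ⟨hV, ?_, fun k x y hk h => ?_⟩
  · exact Finite.of_injective (fun e : X.toGraph.E => (X.toGraph.src e, X.toGraph.tgt e))
      fun e e' h => toGraph_edge_ext (congrArg Prod.fst h) (congrArg Prod.snd h)
  · obtain ⟨e, hs, ht⟩ := toGraph_edge_iff.2 ((rel_of_hasPath h).resolve_left fun h => hk.ne' h.1)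
    exact ⟨e, ⟨hs, ht⟩, fun e' h' => toGraph_edge_ext (h'.1.trans hs.symm) (h'.2.trans ht.symm)⟩

end FinTransRel

instance : vertexRel.EssSurj where
  mem_essImage X := by
    let f : vertexRel.obj ⟨X.toGraph, X.finTransitive_toGraph⟩ ⟶ X :=
      FinTransRel.homMk (X := vertexRel.obj ⟨X.toGraph, X.finTransitive_toGraph⟩)
        FinTransRel.vertexVal fun _ _ h => FinTransRel.toGraph_edge_iff.1 h
    have : IsIso f := FinTransRel.isIso_of_bijective f FinTransRel.vertexVal_bijective
      fun _ _ h => FinTransRel.toGraph_edge_iff.2 h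
    exact ⟨_, ⟨asIso f⟩⟩

instance : vertexRel.IsEquivalence where

theorem nerve_edge_iff {n : L} {x y : (nerve.obj n).V} :
    (∃ e : (nerve.obj n).E, (nerve.obj n).src e = x ∧ (nerve.obj n).tgt e = y) ↔
      nerveVal x < nerveVal y := by
  constructor
  · rintro ⟨e, rfl, rfl⟩
    exact nerveVal_lt e
  · intro h
    exact ⟨L.edge h, nerveVal_injective rfl, nerveVal_injective rfl⟩

/-- The nerve of `n`, as a relation on its vertices, is the strict order on `[n]`. -/
def nerveVertexHom (n : L) : (toTransGraph ⋙ vertexRel).obj n ⟶ toFinTransRel.obj n :=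
  FinTransRel.homMk (X := (toTransGraph ⋙ vertexRel).obj n) (Y := toFinTransRel.obj n)
    nerveVal fun _ _ h => nerve_edge_iff.1 h

instance (n : L) : IsIso (nerveVertexHom n) :=
  FinTransRel.isIso_of_bijective _ ⟨nerveVal_injective, fun i => ⟨L.vert (n := n) i, rfl⟩⟩
    fun _ _ h => nerve_edge_iff.2 h

/-- The equivalence `vertexRel` is compatible with the embeddings of `L`. -/
noncomputable def toTransGraphVertexRelIso : toTransGraph ⋙ vertexRel ≅ toFinTransRel :=
  NatIso.ofComponents (fun n => asIso (nerveVertexHom n)) fun _ => rfl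

/-! ### Free conservative finite cocompletions -/

section General

universe v₁ u₁ v₂ u₂ v₃ u₃

variable {C : Type u₁} [Category.{v₁} C] {D : Type u₂} [Category.{v₂} D]

/-- If whiskering with `y` is bijective on natural transformations, then isomorphisms between
restrictions along `y` lift uniquely. -/
theorem existsUnique_iso_of_bijective {E : Type u} [Category.{v} E] (y : C ⥤ D) {P Q : D ⥤ E}
    (h : ∀ {G H : D ⥤ E}, (G = P ∨ G = Q) →
      Function.Bijective (fun γ : G ⟶ H => Functor.whiskerLeft y γ))
    {F : C ⥤ E} (α : y ⋙ P ≅ F) (β : y ⋙ Q ≅ F) :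
    ∃! γ : P ≅ Q, Functor.isoWhiskerLeft y γ ≪≫ β = α := by
  obtain ⟨γ, hγ⟩ := (h (Or.inl rfl)).2 (α ≪≫ β.symm).hom
  obtain ⟨δ, hδ⟩ := (h (Or.inr rfl)).2 (α ≪≫ β.symm).inv
  have h1 : γ ≫ δ = 𝟙 P := (h (Or.inl rfl)).1 (by
    have := congrArg₂ (· ≫ ·) hγ hδ
    simpa using this)
  have h2 : δ ≫ γ = 𝟙 Q := (h (Or.inr rfl)).1 (by
    have := congrArg₂ (· ≫ ·) hδ hγ
    simpa using this)
  refine ⟨⟨γ, δ, h1, h2⟩, ?_, fun ε hε => ?_⟩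
  · ext1
    change Functor.whiskerLeft y γ ≫ β.hom = α.hom
    simp only at hγ
    simp [hγ]
  · ext1
    refine (h (Or.inl rfl)).1 (Eq.trans ?_ hγ.symm)
    rw [← hε]
    simp

/-- Restriction along the composite of `y` with an equivalence `k` is bijective on natural
transformations if restriction along `y` is. -/
theorem whiskerLeft_bijective_of_iso_comp {D' : Type u₃} [Category.{v₃} D'] {E : Type u}
    [Category.{v} E] {y : C ⥤ D} {y' : C ⥤ D'} (k : D ⥤ D') [k.IsEquivalence] (i : y' ≅ y ⋙ k)
    {G H : D' ⥤ E}
    (h : Function.Bijective (fun γ : k ⋙ G ⟶ k ⋙ H => Functor.whiskerLeft y γ)) :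
    Function.Bijective (fun γ : G ⟶ H => Functor.whiskerLeft y' γ) := by
  have hk : Function.Bijective (fun γ : G ⟶ H => Functor.whiskerLeft k γ) :=
    ((Functor.FullyFaithful.ofFullyFaithful
      (k.asEquivalence.congrLeft (E := E)).inverse).map_bijective G H)
  let W := Functor.isoWhiskerRight i G
  let W' := Functor.isoWhiskerRight i H
  have hc : (fun γ : G ⟶ H => Functor.whiskerLeft y' γ) =
      (fun θ : y ⋙ k ⋙ G ⟶ y ⋙ k ⋙ H => (show y' ⋙ G ⟶ y' ⋙ H from W.hom ≫ θ ≫ W'.inv)) ∘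
        (fun γ : k ⋙ G ⟶ k ⋙ H => Functor.whiskerLeft y γ) ∘
          (fun γ : G ⟶ H => Functor.whiskerLeft k γ) := by
    funext γ
    ext c
    simp [W, W']
  rw [hc]
  refine Function.Bijective.comp ?_ (h.comp hk)
  refine Function.bijective_iff_has_inverse.2
    ⟨fun θ => W.inv ≫ θ ≫ W'.hom, fun θ => ?_, fun θ => ?_⟩
  · change W.inv ≫ (W.hom ≫ θ ≫ W'.inv) ≫ W'.hom = θ
    simp
  · change W.hom ≫ (W.inv ≫ θ ≫ W'.hom) ≫ W'.inv = θ
    simp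

end General

theorem isFree_toFinTransRel :
    IsFreeConservativeFiniteCocompletion.{v, u, 0, 0, 0, 1} toFinTransRel where
  hasFiniteColimits := inferInstance
  full := inferInstance
  faithful := inferInstance
  preserves := inferInstance
  universal E _ _ F hF :=
    ⟨extension F, extensionIso F, inferInstance, fun F'' β hF'' =>
      existsUnique_iso_of_bijective toFinTransRel
        (by rintro G H (rfl | rfl) <;> exact whiskerLeft_toFinTransRel_bijective _ _)
        (extensionIso F) β⟩

theorem isFree_toTransGraph :
    IsFreeConservativeFiniteCocompletion.{v, u, 0, 0, 0, 1} toTransGraph := by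
  let k := vertexRel.inv
  let i : toTransGraph ≅ toFinTransRel ⋙ k :=
    (Functor.rightUnitor _).symm ≪≫
      Functor.isoWhiskerLeft toTransGraph vertexRel.asEquivalence.unitIso ≪≫
      (Functor.associator _ _ _).symm ≪≫ Functor.isoWhiskerRight toTransGraphVertexRelIso k
  exact
    { hasFiniteColimits :=
        ⟨fun J _ _ => Adjunction.hasColimitsOfShape_of_equivalence vertexRel⟩
      full := Functor.Full.of_iso i.symm
      faithful := Functor.Faithful.of_iso i.symm
      preserves := preservesFiniteColimits_of_natIso i.symm
      universal := fun E _ _ F hF =>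
        ⟨vertexRel ⋙ extension F, (Functor.associator _ _ _).symm ≪≫
            Functor.isoWhiskerRight toTransGraphVertexRelIso (extension F) ≪≫ extensionIso F,
          inferInstance, fun F'' β hF'' =>
          existsUnique_iso_of_bijective toTransGraph
            (by
              rintro G H (rfl | rfl) <;>
              exact whiskerLeft_bijective_of_iso_comp k i
                (whiskerLeft_toFinTransRel_bijective _ _)) _ β⟩ }

/-! ### Uniqueness up to equivalence -/

/-- Codes for the finite transitive relations whose underlying set is a finite ordinal. -/
structure OrdinalRel : Type where
  /-- the number of elements -/
  len : ℕ
  /-- the relation -/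
  rel : Fin len → Fin len → Prop
  /-- it is transitive -/
  trans : ∀ a b c, rel a b → rel b c → rel a c

/-- The finite transitive relation given by a code. -/
def OrdinalRel.toFinTransRel (X : OrdinalRel) : FinTransRel :=
  ⟨Fin X.len, inferInstance, X.rel, X.trans⟩

/-- A category equivalent to `FinTransRel` whose objects form a type in a prescribed universe. -/
abbrev SmallFinTransRel : Type u :=
  InducedCategory FinTransRel fun X : ULift.{u} OrdinalRel => X.down.toFinTransRel

/-- The embedding of the small model into `FinTransRel`. -/
abbrev smallInclusion : SmallFinTransRel.{u} ⥤ FinTransRel :=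
  inducedFunctor fun X : ULift.{u} OrdinalRel => X.down.toFinTransRel

instance : smallInclusion.{u}.EssSurj where
  mem_essImage X := by
    have := X.finite
    let e := Finite.equivFin X.carrier
    let Y : OrdinalRel := ⟨Nat.card X.carrier, fun a b => X.rel (e.symm a) (e.symm b),
      fun _ _ _ => X.trans _ _ _⟩
    let f : Y.toFinTransRel ⟶ X := FinTransRel.homMk (X := Y.toFinTransRel) e.symm fun _ _ h => h
    have : IsIso f := FinTransRel.isIso_of_bijective f e.symm.bijective fun _ _ h => h
    exact ⟨(⟨Y⟩ : ULift.{u} OrdinalRel), ⟨asIso f⟩⟩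

instance : smallInclusion.{u}.IsEquivalence where

/-- `FinTransRel` is equivalent to a category in any prescribed universes. -/
noncomputable def smallModelEquivalence : FinTransRel ≌ ULiftHom.{v} SmallFinTransRel.{u} :=
  smallInclusion.{u}.asEquivalence.symm.trans ULiftHom.equiv

/-- Any free conservative finite cocompletion of `L` is equivalent to `FinTransRel`. The universal
property is only available for test categories in the universes of `D`, so it is applied to a small
model of `FinTransRel` lifted to these universes. -/
theorem exists_equivalence_finTransRel (D : Type u) [Category.{v} D] (y : L ⥤ D)
    (h : IsFreeConservativeFiniteCocompletion.{v, u, 0, 0, v, u} y) :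
    ∃ e : D ≌ FinTransRel, Nonempty (y ⋙ e.functor ≅ toFinTransRel) := by
  have := h.hasFiniteColimits
  have := h.preserves
  let k := smallModelEquivalence.{v, u}
  have : HasFiniteColimits (ULiftHom.{v} SmallFinTransRel.{u}) :=
    ⟨fun J _ _ => Adjunction.hasColimitsOfShape_of_equivalence k.inverse⟩
  obtain ⟨P₀, α, _, -⟩ := h.universal (ULiftHom.{v} SmallFinTransRel.{u})
    (toFinTransRel ⋙ k.functor) inferInstance
  let P : D ⥤ FinTransRel := P₀ ⋙ k.inverse
  let a : y ⋙ P ≅ toFinTransRel := (Functor.associator _ _ _).symm ≪≫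
    Functor.isoWhiskerRight α k.inverse ≪≫ Functor.associator _ _ _ ≪≫
    Functor.isoWhiskerLeft toFinTransRel k.unitIso.symm ≪≫ Functor.rightUnitor _
  let Q : FinTransRel ⥤ D := extension y
  let b : toFinTransRel ⋙ Q ≅ y := extensionIso y
  -- Both `𝟭 D` and `P ⋙ Q` extend `y` to `D`, so both are isomorphic to the extension `I`.
  obtain ⟨I, β, _, hI⟩ := h.universal D y inferInstance
  obtain ⟨γ, -⟩ := hI (𝟭 D) (Functor.rightUnitor y) inferInstance
  obtain ⟨γ', -⟩ := hI (P ⋙ Q)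
    ((Functor.associator _ _ _).symm ≪≫ Functor.isoWhiskerRight a Q ≪≫ b) inferInstance
  obtain ⟨δ, -⟩ := existsUnique_iso_of_bijective toFinTransRel (P := Q ⋙ P) (Q := 𝟭 _)
    (by rintro G H (rfl | rfl) <;> exact whiskerLeft_toFinTransRel_bijective _ _)
    ((Functor.associator _ _ _).symm ≪≫ Functor.isoWhiskerRight b P ≪≫ a)
    (Functor.rightUnitor _)
  exact ⟨CategoryTheory.Equivalence.mk P Q (γ.symm ≪≫ γ') δ, ⟨a⟩⟩

theorem exists_equivalence_transGraph {D : Type u} [Category.{v} D] {y : L ⥤ D}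
    (e : D ≌ FinTransRel) (i : y ⋙ e.functor ≅ toFinTransRel) :
    ∃ e : D ≌ TransGraph, Nonempty (y ⋙ e.functor ≅ toTransGraph) := by
  refine ⟨e.trans vertexRel.asEquivalence.symm, ⟨?_⟩⟩
  exact (Functor.associator _ _ _).symm ≪≫
    Functor.isoWhiskerRight (i ≪≫ toTransGraphVertexRelIso.symm) vertexRel.inv ≪≫
    Functor.associator _ _ _ ≪≫
    Functor.isoWhiskerLeft toTransGraph vertexRel.asEquivalence.unitIso.symm ≪≫
    Functor.rightUnitor _

end InsertionPatch

theorem mainTheorem2 :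
    InsertionPatch.IsFreeConservativeFiniteCocompletion.{v, u, 0, 0, 0, 1}
      InsertionPatch.toTransGraph ∧
    InsertionPatch.IsFreeConservativeFiniteCocompletion.{v, u, 0, 0, 0, 1}
      InsertionPatch.toFinTransRel ∧
    InsertionPatch.vertexRel.IsEquivalence ∧
    Nonempty (InsertionPatch.toTransGraph ⋙ InsertionPatch.vertexRel ≅
      InsertionPatch.toFinTransRel) ∧
    ∀ (D : Type u) [Category.{v} D] (y : InsertionPatch.L ⥤ D),
      InsertionPatch.IsFreeConservativeFiniteCocompletion.{v, u, 0, 0, v, u} y →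
        (∃ e : D ≌ InsertionPatch.TransGraph,
          Nonempty (y ⋙ e.functor ≅ InsertionPatch.toTransGraph)) ∧
        (∃ e : D ≌ InsertionPatch.FinTransRel,
          Nonempty (y ⋙ e.functor ≅ InsertionPatch.toFinTransRel)) := by
  refine ⟨InsertionPatch.isFree_toTransGraph, InsertionPatch.isFree_toFinTransRel, inferInstance,
    ⟨InsertionPatch.toTransGraphVertexRelIso⟩, fun D _ y h => ?_⟩
  obtain ⟨e, ⟨i⟩⟩ := InsertionPatch.exists_equivalence_finTransRel D y h
  exact ⟨InsertionPatch.exists_equivalence_transGraph e i, e, ⟨i⟩⟩
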